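/- Let $C_1, C_2$ be connected compact Riemann surfaces, let $f\colon C_1\to\mathbb{CP}^1$ and $g\colon C_2\to\mathbb{CP}^1$ be non-constant holomorphic functions, let $S\subset\mathbb{CP}^1$ be a finite set such that $f$ and $g$ are non-ramified outside of $S$ (that is, $df_x\neq 0$ whenever $f(x)\notin S$, and likewise for $g$), and let $z_0\in\mathbb{CP}^1\setminus S$. Every loop in $\mathbb{CP}^1\setminus S$ based at $z_0$ induces, by lifting it through $f$ and through $g$, a permutation of the finite set $f^{-1}\{z_0\}\times g^{-1}\{z_0\}$. Let $\Gamma(f,g)$ be the permutation group generated by all these permutations, and let $o(f,g)$ be the number of its transitivity sets (orbits) on $f^{-1}\{z_0\}\times g^{-1}\{z_0\}$. The pair $f,g$ is called irreducible if $o(f,g)=1$. For $a\in f^{-1}\{z_0\}$ let $\Gamma_{f,a}\le\pi_1(\mathbb{CP}^1\setminus S,z_0)$ be the image of $f_\star\colon\pi_1(C_1\setminus f^{-1}(S),a)\to\pi_1(\mathbb{CP}^1\setminus S,z_0)$, and define $\Gamma_{g,b}$ for $b\in g^{-1}\{z_0\}$ in the same way. Then the pair $f,g$ is irreducible if and only if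 for all $a\in f^{-1}\{z_0\}$ and $b\in g^{-1}\{z_0\}$ $$\Gamma_{f,a}\,\Gamma_{g,b}=\Gamma_{g,b}\,\Gamma_{f,a}=\pi_1(\mathbb{CP}^1\setminus S,z_0).$$ -/

import Mathlib

open scoped Manifold Topology Pointwise

noncomputable section

/-! ### The Riemann sphere as a complex manifold -/

/-- The complex projective line `ℂℙ¹ = ℂ ∪ {∞}`, with the topology of the one-point
compactification of `ℂ`. -/
abbrev CP1 : Type := OnePoint ℂ

namespace CP1

/-- The involution `z ↦ 1 / z` of the Riemann sphere, exchanging `0` and `∞`. -/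
def invFun (w : CP1) : CP1 :=
  w.elim ((0 : ℂ) : CP1) (fun z : ℂ => if z = 0 then OnePoint.infty else ((z⁻¹ : ℂ) : CP1))

theorem invFun_infty : invFun OnePoint.infty = ((0 : ℂ) : CP1) := rfl

theorem invFun_zero : invFun ((0 : ℂ) : CP1) = OnePoint.infty := by
  simp [invFun]

theorem invFun_coe {z : ℂ} (hz : z ≠ 0) : invFun (z : CP1) = ((z⁻¹ : ℂ) : CP1) := by
  simp [invFun, hz]

theorem invFun_invFun (w : CP1) : invFun (invFun w) = w := by
  induction w using OnePoint.rec with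
  | infty => rw [invFun_infty, invFun_zero]
  | coe z =>
    by_cases hz : z = 0
    · subst hz; rw [invFun_zero, invFun_infty]
    · rw [invFun_coe hz, invFun_coe (inv_ne_zero hz), inv_inv]

theorem continuous_invFun : Continuous invFun := by
  rw [continuous_iff_continuousAt]
  intro w
  induction w using OnePoint.rec with
  | infty =>
    rw [OnePoint.continuousAt_infty', invFun_infty, OnePoint.nhds_coe_eq,
      Filter.coclosedCompact_eq_cocompact, ← Metric.cobounded_eq_cocompact]
    have h : Filter.Tendsto (fun z : ℂ => ((z⁻¹ : ℂ) : CP1)) (Bornology.cobounded ℂ)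
        (Filter.map ((↑) : ℂ → CP1) (𝓝 0)) :=
      Filter.tendsto_map.comp Filter.tendsto_inv₀_cobounded
    refine h.congr' ?_
    filter_upwards [Bornology.eventually_ne_cobounded (0 : ℂ)] with z hz
    exact (invFun_coe hz).symm
  | coe z =>
    rw [OnePoint.continuousAt_coe]
    by_cases hz : z = 0
    · subst hz
      rw [continuousAt_iff_punctured_nhds]
      change Filter.Tendsto _ _ (𝓝 (invFun ((0 : ℂ) : CP1)))
      rw [invFun_zero]
      have h : Filter.Tendsto (fun z : ℂ => ((z⁻¹ : ℂ) : CP1)) (𝓝[≠] 0)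
          (𝓝 OnePoint.infty) := by
        refine OnePoint.tendsto_coe_infty.comp ?_
        rw [Filter.coclosedCompact_eq_cocompact, ← Metric.cobounded_eq_cocompact]
        exact Filter.tendsto_inv₀_nhdsNE_zero
      refine h.congr' ?_
      filter_upwards [self_mem_nhdsWithin] with z hz
      exact (invFun_coe hz).symm
    · have h : ContinuousAt (fun z : ℂ => ((z⁻¹ : ℂ) : CP1)) z :=
        OnePoint.continuous_coe.continuousAt.comp (continuousAt_inv₀ hz)
      refine h.congr ?_
      filter_upwards [isOpen_ne.mem_nhds hz] with z hz
      exact (invFun_coe hz).symm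

/-- The involution `z ↦ 1 / z` as a homeomorphism of the Riemann sphere. -/
def invHomeo : CP1 ≃ₜ CP1 where
  toFun := invFun
  invFun := invFun
  left_inv := invFun_invFun
  right_inv := invFun_invFun
  continuous_toFun := continuous_invFun
  continuous_invFun := continuous_invFun

/-- The affine chart `z ↦ z` on the complement of `∞`. -/
def chartZero : OpenPartialHomeomorph CP1 ℂ :=
  (OnePoint.isOpenEmbedding_coe.toOpenPartialHomeomorph ((↑) : ℂ → CP1)).symm

/-- The chart `w ↦ 1 / w` (with `∞ ↦ 0`) on the complement of `0`. -/
def chartInfty : OpenPartialHomeomorph CP1 ℂ :=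
  invHomeo.toOpenPartialHomeomorph.trans chartZero

theorem chartZero_source : chartZero.source = Set.range ((↑) : ℂ → CP1) := by
  simp [chartZero]

theorem chartZero_target : chartZero.target = Set.univ := by
  simp [chartZero]

theorem chartZero_symm_apply (z : ℂ) : chartZero.symm z = (z : CP1) := rfl

theorem chartZero_coe (z : ℂ) : chartZero (z : CP1) = z :=
  chartZero.right_inv (x := z) (by rw [chartZero_target]; trivial)

theorem chartInfty_apply (w : CP1) : chartInfty w = chartZero (invFun w) := rfl

theorem chartInfty_symm_apply (z : ℂ) : chartInfty.symm z = invFun (z : CP1) := rfl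

theorem chartInfty_source : chartInfty.source = invFun ⁻¹' Set.range ((↑) : ℂ → CP1) := by
  simp [chartInfty, chartZero_source, invHomeo]

/-- The standard atlas of the Riemann sphere, with the two charts `z` and `1 / z`. -/
instance : ChartedSpace ℂ CP1 where
  atlas := {chartZero, chartInfty}
  chartAt w := w.elim chartInfty (fun _ => chartZero)
  mem_chart_source w := by
    induction w using OnePoint.rec with
    | infty =>
      change OnePoint.infty ∈ chartInfty.source
      rw [chartInfty_source]
      exact ⟨0, rfl⟩
    | coe z =>
      change (z : CP1) ∈ chartZero.source
      rw [chartZero_source]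
      exact ⟨z, rfl⟩
  chart_mem_atlas w := by
    induction w using OnePoint.rec with
    | infty => exact Or.inr rfl
    | coe z => exact Or.inl rfl

instance : IsManifold 𝓘(ℂ) 1 CP1 := by
  apply isManifold_of_contDiffOn
  intro e e' he he'
  have key : ∀ z : ℂ, invFun (z : CP1) ∈ Set.range ((↑) : ℂ → CP1) → z ≠ 0 := by
    rintro z ⟨y, hy⟩ rfl
    rw [invFun_zero] at hy
    exact OnePoint.coe_ne_infty y hy
  rcases he with rfl | rfl <;> rcases he' with rfl | rfl
  · refine contDiffOn_id.congr fun z _ => ?_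
    simp [chartZero_symm_apply, chartZero_coe]
  · have h : ContDiffOn ℂ 1 (fun z : ℂ => z⁻¹) {z | z ≠ 0} := fun z hz =>
      (contDiffAt_inv ℂ hz).contDiffWithinAt
    have hs : ∀ z ∈ (𝓘(ℂ)).symm ⁻¹' (chartZero.symm ≫ₕ chartInfty).source ∩ Set.range 𝓘(ℂ),
        z ≠ 0 := by
      intro z hz
      apply key
      simpa [chartInfty_source, chartZero_symm_apply, chartZero_target] using hz
    refine (h.mono hs).congr fun z hz => ?_
    simp [chartZero_symm_apply, chartInfty_apply, invFun_coe (hs z hz), chartZero_coe]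
  · have h : ContDiffOn ℂ 1 (fun z : ℂ => z⁻¹) {z | z ≠ 0} := fun z hz =>
      (contDiffAt_inv ℂ hz).contDiffWithinAt
    have hs : ∀ z ∈ (𝓘(ℂ)).symm ⁻¹' (chartInfty.symm ≫ₕ chartZero).source ∩ Set.range 𝓘(ℂ),
        z ≠ 0 := by
      intro z hz
      have hz' : chartInfty.symm z ∈ chartZero.source := hz.1.2
      rw [chartInfty_symm_apply, chartZero_source] at hz'
      exact key z hz'
    refine (h.mono hs).congr fun z hz => ?_
    simp [chartInfty_symm_apply, invFun_coe (hs z hz), chartZero_coe]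
  · refine contDiffOn_id.congr fun z _ => ?_
    simp [chartInfty_symm_apply, chartInfty_apply, invFun_invFun, chartZero_coe]

end CP1

/-! ### Holomorphic functions on compact Riemann surfaces -/

section Functions

variable {C : Type*} [TopologicalSpace C] [ChartedSpace ℂ C]

/-- `f : C → ℂℙ¹` is a non-constant holomorphic function, non-ramified outside of `S`: the
differential of `f` vanishes at no point `x` with `f x ∉ S`. -/
structure IsHolomorphicUnramifiedOutside (f : C → CP1) (S : Set CP1) : Prop where
  holomorphic : MDifferentiable 𝓘(ℂ) 𝓘(ℂ) f
  nonconstant : ∃ x y, f x ≠ f y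
  unramified : ∀ x, f x ∉ S → mfderiv 𝓘(ℂ) 𝓘(ℂ) f x ≠ 0

namespace IsHolomorphicUnramifiedOutside

variable {f : C → CP1} {S : Set CP1}

/-- The inverse function theorem: `f` is a local homeomorphism over the complement of `S`. -/
theorem isLocalHomeomorphOn [IsManifold 𝓘(ℂ) 1 C]
    (hf : IsHolomorphicUnramifiedOutside f S) : IsLocalHomeomorphOn f (f ⁻¹' Sᶜ) := by
  refine IsLocalHomeomorphOn.mk _ _ fun x hx => ?_
  have hcont : Continuous f := hf.holomorphic.continuous
  let φ := chartAt ℂ x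
  let ψ := chartAt ℂ (f x)
  let g : ℂ → ℂ := fun z => ψ (f (φ.symm z))
  have hxφ : x ∈ φ.source := mem_chart_source ℂ x
  have hxψ : f x ∈ ψ.source := mem_chart_source ℂ (f x)
  have hopen : IsOpen (φ.target ∩ φ.symm ⁻¹' (f ⁻¹' ψ.source)) :=
    φ.symm.isOpen_inter_preimage (ψ.open_source.preimage hcont)
  have hmem : φ x ∈ φ.target ∩ φ.symm ⁻¹' (f ⁻¹' ψ.source) :=
    ⟨φ.map_source hxφ, by simpa [φ.left_inv hxφ] using hxψ⟩
  have hg : DifferentiableOn ℂ g (φ.target ∩ φ.symm ⁻¹' (f ⁻¹' ψ.source)) := by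
    have := (mdifferentiable_iff.1 hf.holomorphic).2 x (f x)
    simpa [g, φ, ψ, Function.comp_def] using this
  have hga : AnalyticAt ℂ g (φ x) := hg.analyticAt (hopen.mem_nhds hmem)
  have hd : deriv g (φ x) ≠ 0 := by
    intro h0
    apply hf.unramified x hx
    have h1 : mfderiv 𝓘(ℂ) 𝓘(ℂ) f x = fderiv ℂ g (φ x) := by
      rw [(hf.holomorphic x).mfderiv]
      simp [writtenInExtChartAt, g, φ, ψ, Function.comp_def]
      rfl
    have h2 : fderiv ℂ g (φ x) = 0 := by
      ext
      simpa using h0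
    rw [h1, h2]
    rfl
  have hstrict : HasStrictDerivAt g (deriv g (φ x)) (φ x) := hga.hasStrictDerivAt
  let G := (hstrict.hasStrictFDerivAt_equiv hd).toOpenPartialHomeomorph g
  have hG : φ x ∈ G.source :=
    (hstrict.hasStrictFDerivAt_equiv hd).mem_toOpenPartialHomeomorph_source
  let φ' := φ.restrOpen (f ⁻¹' ψ.source) (ψ.open_source.preimage hcont)
  refine ⟨(φ'.trans G).trans ψ.symm, ?_, ?_⟩
  · have hgx : g (φ x) = ψ (f x) := by simp [g, φ.left_inv hxφ]
    have : G (φ x) ∈ ψ.target := by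
      change g (φ x) ∈ _
      rw [hgx]; exact ψ.map_source hxψ
    exact ⟨⟨⟨hxφ, hxψ⟩, hG⟩, this⟩
  · rintro y ⟨⟨⟨hy1, hy2⟩, -⟩, -⟩
    change f y = ψ.symm (ψ (f (φ.symm (φ y))))
    rw [φ.left_inv hy1, ψ.left_inv hy2]

/-- The restriction `C ∖ f⁻¹(S) → ℂℙ¹ ∖ S` of `f` is a covering map. -/
theorem isCoveringMap [IsManifold 𝓘(ℂ) 1 C] [T2Space C] [CompactSpace C]
    (hf : IsHolomorphicUnramifiedOutside f S) : IsCoveringMap (Sᶜ.restrictPreimage f) :=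
  (IsCoveringMapOn.of_isLocalHomeomorphOn hf.holomorphic.continuous
    hf.isLocalHomeomorphOn).isCoveringMap_restrictPreimage

end IsHolomorphicUnramifiedOutside

end Functions

/-! ### The subgroups `Γ_{f,a}` and the number `o(f,g)` -/

section Pairs

variable {C C₁ C₂ : Type*}
  [TopologicalSpace C] [ChartedSpace ℂ C] [IsManifold 𝓘(ℂ) 1 C] [T2Space C] [CompactSpace C]
  [TopologicalSpace C₁] [ChartedSpace ℂ C₁] [IsManifold 𝓘(ℂ) 1 C₁] [T2Space C₁] [CompactSpace C₁]
  [TopologicalSpace C₂] [ChartedSpace ℂ C₂] [IsManifold 𝓘(ℂ) 1 C₂] [T2Space C₂] [CompactSpace C₂]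
  {S : Set CP1} {f : C₁ → CP1} {g : C₂ → CP1}

/-- The fibre `p⁻¹{z₀}` over a point `z₀ ∉ S`, as a set of points of `C ∖ p⁻¹(S)`. -/
abbrev punctFiber (p : C → CP1) (z₀ : ↥Sᶜ) : Set ↥(p ⁻¹' Sᶜ) :=
  Sᶜ.restrictPreimage p ⁻¹' {z₀}

/-- `Γ_{p,e}`: the image of `p_⋆ : π₁(C ∖ p⁻¹(S), e) → π₁(ℂℙ¹ ∖ S, z₀)`, for `e ∈ p⁻¹{z₀}`. -/
def coveringSubgroup {p : C → CP1} (hp : IsHolomorphicUnramifiedOutside p S)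
    {z₀ : ↥Sᶜ} (e : punctFiber p z₀) : Subgroup (FundamentalGroup ↥Sᶜ z₀) :=
  (FundamentalGroup.mapOfEq ⟨Sᶜ.restrictPreimage p, hp.isCoveringMap.continuous⟩ e.2).range

/-- The permutation of `f⁻¹{z₀} × g⁻¹{z₀}` induced by a loop `γ` in `ℂℙ¹ ∖ S`: it sends `(a, b)`
to the pair of end points of the liftings of `γ` by `f` and by `g` which start at `a` and `b`. -/
def pairPerm (hf : IsHolomorphicUnramifiedOutside f S) (hg : IsHolomorphicUnramifiedOutside g S)
    (z₀ : ↥Sᶜ) (γ : FundamentalGroup ↥Sᶜ z₀) :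
    Equiv.Perm (punctFiber f z₀ × punctFiber g z₀) :=
  Equiv.prodCongr (hf.isCoveringMap.monodromyPerm z₀ γ) (hg.isCoveringMap.monodromyPerm z₀ γ)

/-- `Γ(f,g)`: the permutation group of `f⁻¹{z₀} × g⁻¹{z₀}` generated by the permutations which
the loops in `ℂℙ¹ ∖ S` based at `z₀` induce by simultaneous lifting. -/
def pairMonodromyGroup (hf : IsHolomorphicUnramifiedOutside f S)
    (hg : IsHolomorphicUnramifiedOutside g S) (z₀ : ↥Sᶜ) :
    Subgroup (Equiv.Perm (punctFiber f z₀ × punctFiber g z₀)) :=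
  Subgroup.closure (Set.range (pairPerm hf hg z₀))

/-- `o(f,g)`: the number of transitivity sets of `Γ(f,g)` on `f⁻¹{z₀} × g⁻¹{z₀}`. -/
def numTransitivitySets (hf : IsHolomorphicUnramifiedOutside f S)
    (hg : IsHolomorphicUnramifiedOutside g S) (z₀ : ↥Sᶜ) : ℕ :=
  Nat.card (MulAction.orbitRel.Quotient (pairMonodromyGroup hf hg z₀)
    (punctFiber f z₀ × punctFiber g z₀))

/-- The pair `f, g` is irreducible if `o(f,g) = 1`. -/
def IsIrreduciblePair (hf : IsHolomorphicUnramifiedOutside f S)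
    (hg : IsHolomorphicUnramifiedOutside g S) (z₀ : ↥Sᶜ) : Prop :=
  numTransitivitySets hf hg z₀ = 1

end Pairs

end

/-!
Write `Γ_a = Γ_{f,a}`, `Γ_b = Γ_{g,b}` and `π = π₁(ℂℙ¹ ∖ S, z₀)`. By uniqueness of liftings, `Γ_a`
and `Γ_b` are the stabilizers of `a` and `b` under the monodromy actions of `π` on the two fibres
(`IsCoveringMap.mem_range_mapOfEq_iff`), and `Γ(f,g)` is the image of `π` acting diagonally on
their product. The theorem is then the statement that, for two transitive actions, the diagonal
action on the product is transitive if and only if `Γ_a Γ_b = π` for all `a` and `b`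
(`exists_diagonal_eq_of_mul_eq_univ` and `stabilizer_mul_stabilizer_eq_univ`). Indeed both
conditions say that the stabilizer `Γ_a` of a point `a` of the first fibre acts transitively on the
second fibre `π / Γ_b`.

What has to be supplied about Riemann surfaces is that the monodromy action of `π` on a fibre of
`f` is transitive and that the fibre is nonempty. For the second, a non-constant holomorphic map is
open, so the image of the compact surface is clopen in the connected sphere
(`surjective_of_mdifferentiable`). For the first, it suffices to join two points of the fibre by a
path in `C ∖ f⁻¹(S)`. This open set is connected (`isPathConnected_preimage_compl`) because
`f⁻¹(S)` is discrete, by the identity theorem, and a punctured disc is connected, so that removing a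
discrete closed set does not disconnect a connected surface.
-/

open Set Filter

/-! ### Connectedness after removing a nowhere dense set -/

/-- A dense subset of a connected space is connected as soon as it is connected locally around every
point of the ambient space: if two relatively open pieces covered it, their closures would share a
point, around which the local connectedness is violated. -/
theorem Dense.isPreconnected_of_forall_exists_nhds {X : Type*} [TopologicalSpace X]
    [PreconnectedSpace X] {U : Set X} (hU : Dense U)
    (hloc : ∀ x, ∃ N ∈ 𝓝 x, IsPreconnected (N ∩ U)) : IsPreconnected U := by
  intro u v hu hv huv hUu hUv
  have hcov : (univ : Set X) ⊆ closure (U ∩ u) ∪ closure (U ∩ v) := by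
    rw [← closure_union, ← inter_union_distrib_left, inter_eq_left.2 huv, hU.closure_eq]
  obtain ⟨x, -, hxu, hxv⟩ := isPreconnected_closed_iff.1 isPreconnected_univ _ _
    isClosed_closure isClosed_closure hcov
    (by simpa using hUu.mono subset_closure) (by simpa using hUv.mono subset_closure)
  obtain ⟨N, hN, hNU⟩ := hloc x
  obtain ⟨y, hyN, hyU, hyu⟩ := mem_closure_iff_nhds.1 hxu N hN
  obtain ⟨z, hzN, hzU, hzv⟩ := mem_closure_iff_nhds.1 hxv N hN
  obtain ⟨w, ⟨-, hwU⟩, hw⟩ := hNU u v hu hv (inter_subset_right.trans huv)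
    ⟨y, ⟨hyN, hyU⟩, hyu⟩ ⟨z, ⟨hzN, hzU⟩, hzv⟩
  exact ⟨w, hwU, hw⟩

/-- A punctured disc is the image of a half-plane under the exponential map. -/
theorem Complex.isPreconnected_ball_diff_singleton (c : ℂ) (r : ℝ) :
    IsPreconnected (Metric.ball c r \ {c}) := by
  rcases le_or_gt r 0 with hr | hr
  · simpa [Metric.ball_eq_empty.2 hr] using isPreconnected_empty
  have himage : Metric.ball c r \ {c} =
      (fun w => c + Complex.exp w) '' {w : ℂ | w.re < Real.log r} := by
    ext z
    constructor
    · rintro ⟨hz, hzc⟩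
      have hne : z - c ≠ 0 := sub_ne_zero.2 hzc
      refine ⟨Complex.log (z - c), ?_, by simp [Complex.exp_log hne]⟩
      rw [mem_ball_iff_norm] at hz
      change (Complex.log (z - c)).re < _
      rw [Complex.log_re]
      exact Real.log_lt_log (norm_pos_iff.2 hne) hz
    · rintro ⟨w, hw, rfl⟩
      refine ⟨?_, by simp [Complex.exp_ne_zero]⟩
      rw [mem_ball_iff_norm, add_sub_cancel_left, Complex.norm_exp]
      exact (Real.lt_log_iff_exp_lt hr).1 hw
  rw [himage]
  exact (convex_halfSpace_re_lt _).isPreconnected.image _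
    (continuous_const.add Complex.continuous_exp).continuousOn

theorem ChartedSpace.nhdsNE_neBot {C : Type*} [TopologicalSpace C] [ChartedSpace ℂ C] (x : C) :
    (𝓝[≠] x).NeBot := by
  rw [neBot_iff, Ne, ← isOpen_singleton_iff_punctured_nhds]
  intro hx
  have himage := (chartAt ℂ x).isOpen_image_of_subset_source hx
    (singleton_subset_iff.2 (mem_chart_source ℂ x))
  rw [image_singleton] at himage
  exact not_isOpen_singleton _ himage

theorem dense_of_eventually_nhdsNE_mem {C : Type*} [TopologicalSpace C] [ChartedSpace ℂ C]
    {U : Set C} (hU : ∀ x, ∀ᶠ y in 𝓝[≠] x, y ∈ U) : Dense U := by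
  intro x
  have := ChartedSpace.nhdsNE_neBot x
  exact mem_closure_iff_frequently.2 ((hU x).frequently.filter_mono nhdsWithin_le_nhds)

/-- Removing a closed discrete subset from a connected surface leaves it connected. -/
theorem isPreconnected_of_eventually_nhdsNE_mem {C : Type*} [TopologicalSpace C]
    [ChartedSpace ℂ C] [PreconnectedSpace C] {U : Set C}
    (hU : ∀ x, ∀ᶠ y in 𝓝[≠] x, y ∈ U) : IsPreconnected U := by
  -- Around `x`, take `N` to be a coordinate disc all of whose points, except perhaps `x`, are in `U`.
  have key : ∀ x : C, ∃ N ∈ 𝓝 x, IsPreconnected (N \ {x}) ∧ N \ {x} ⊆ U := by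
    intro x
    let φ := chartAt ℂ x
    have hxφ : x ∈ φ.source := mem_chart_source ℂ x
    have hφU : ∀ᶠ w in 𝓝 (φ x), w ∈ φ.target ∧ (φ.symm w ≠ x → φ.symm w ∈ U) := by
      refine Eventually.and (φ.open_target.mem_nhds (φ.map_source hxφ)) ?_
      exact (φ.tendsto_symm hxφ).eventually (eventually_nhdsWithin_iff.1 (hU x))
    obtain ⟨r, hr, hball⟩ := Metric.eventually_nhds_iff_ball.1 hφU
    have himage : φ.symm '' Metric.ball (φ x) r \ {x} =
        φ.symm '' (Metric.ball (φ x) r \ {φ x}) := by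
      ext y
      constructor
      · rintro ⟨⟨w, hw, rfl⟩, hy⟩
        refine ⟨w, ⟨hw, fun h => hy ?_⟩, rfl⟩
        rw [mem_singleton_iff.1 h]
        exact φ.left_inv hxφ
      · rintro ⟨w, ⟨hw, hne⟩, rfl⟩
        refine ⟨⟨w, hw, rfl⟩, fun h => hne ?_⟩
        rw [← mem_singleton_iff.1 h, φ.right_inv (hball w hw).1]
        rfl
    have hcont : ContinuousOn φ.symm (Metric.ball (φ x) r) :=
      φ.continuousOn_symm.mono fun w hw => (hball w hw).1
    refine ⟨φ.symm '' Metric.ball (φ x) r, ?_, ?_, ?_⟩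
    · have := φ.symm.image_mem_nhds (φ.map_source hxφ) (Metric.ball_mem_nhds (φ x) hr)
      rwa [φ.left_inv hxφ] at this
    · rw [himage]
      exact (Complex.isPreconnected_ball_diff_singleton _ _).image _ (hcont.mono sdiff_subset)
    · rintro _ ⟨⟨w, hw, rfl⟩, hne⟩
      exact (hball w hw).2 hne
  refine (dense_of_eventually_nhdsNE_mem hU).isPreconnected_of_forall_exists_nhds fun x => ?_
  obtain ⟨N, hN, hconn, hNU⟩ := key x
  have hx : x ∈ closure (N \ {x}) := by
    have := ChartedSpace.nhdsNE_neBot x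
    have hev : ∀ᶠ y in 𝓝[≠] x, y ∈ N \ {x} :=
      inter_mem (mem_nhdsWithin_of_mem_nhds hN) self_mem_nhdsWithin
    exact mem_closure_iff_frequently.2 (hev.frequently.filter_mono nhdsWithin_le_nhds)
  refine ⟨N, hN, hconn.subset_closure (fun y hy => ⟨hy.1, hNU hy⟩) fun y hy => ?_⟩
  by_cases hyx : y = x
  · rwa [hyx]
  · exact subset_closure ⟨hy.1, hyx⟩

/-! ### Non-constant holomorphic maps between Riemann surfaces -/

theorem eventually_eq_of_eventually_chartAt_eq {C M : Type*}
    [TopologicalSpace C] [ChartedSpace ℂ C] [TopologicalSpace M] [ChartedSpace ℂ M] {f : C → M}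
    (hf : Continuous f) {x : C}
    (h : ∀ᶠ w in 𝓝 (chartAt ℂ x x), chartAt ℂ (f x) (f ((chartAt ℂ x).symm w)) =
      chartAt ℂ (f x) (f x)) : ∀ᶠ y in 𝓝 x, f y = f x := by
  have hxφ := mem_chart_source ℂ x
  filter_upwards [((chartAt ℂ x).continuousAt hxφ).eventually h,
    (chartAt ℂ x).open_source.mem_nhds hxφ,
    hf.continuousAt.eventually ((chartAt ℂ (f x)).open_source.mem_nhds (mem_chart_source ℂ (f x)))]
    with y hy hyφ hyψ
  rw [(chartAt ℂ x).left_inv hyφ] at hy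
  exact (chartAt ℂ (f x)).injOn hyψ (mem_chart_source ℂ (f x)) hy

section Holomorphic

variable {C M : Type*} [TopologicalSpace C] [ChartedSpace ℂ C] [IsManifold 𝓘(ℂ) 1 C]
  [TopologicalSpace M] [ChartedSpace ℂ M] [IsManifold 𝓘(ℂ) 1 M] {f : C → M}

/-- On a small coordinate disc, a holomorphic map is given by an analytic function. -/
theorem MDifferentiable.exists_ball_analyticOnNhd (hf : MDifferentiable 𝓘(ℂ) 𝓘(ℂ) f) (x : C) :
    ∃ r > 0, Metric.ball (chartAt ℂ x x) r ⊆ (chartAt ℂ x).target ∧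
      (∀ w ∈ Metric.ball (chartAt ℂ x x) r,
        f ((chartAt ℂ x).symm w) ∈ (chartAt ℂ (f x)).source) ∧
      AnalyticOnNhd ℂ (fun w => chartAt ℂ (f x) (f ((chartAt ℂ x).symm w)))
        (Metric.ball (chartAt ℂ x x) r) := by
  let φ := chartAt ℂ x
  let ψ := chartAt ℂ (f x)
  have hxφ : x ∈ φ.source := mem_chart_source ℂ x
  have hopen : IsOpen (φ.target ∩ φ.symm ⁻¹' (f ⁻¹' ψ.source)) :=
    φ.symm.isOpen_inter_preimage (ψ.open_source.preimage hf.continuous)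
  have hmem : φ x ∈ φ.target ∩ φ.symm ⁻¹' (f ⁻¹' ψ.source) :=
    ⟨φ.map_source hxφ, by simp [φ, ψ]⟩
  have hdiff : DifferentiableOn ℂ (fun w => ψ (f (φ.symm w)))
      (φ.target ∩ φ.symm ⁻¹' (f ⁻¹' ψ.source)) := by
    have := (mdifferentiable_iff.1 hf).2 x (f x)
    simpa [φ, ψ, Function.comp_def] using this
  obtain ⟨r, hr, hball⟩ := Metric.isOpen_iff.1 hopen _ hmem
  exact ⟨r, hr, fun w hw => (hball hw).1, fun w hw => (hball hw).2,
    (hdiff.mono hball).analyticOnNhd Metric.isOpen_ball⟩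

/-- The identity theorem: a holomorphic map on a connected Riemann surface which is constant near
some point is constant. -/
theorem MDifferentiable.eq_of_eventually_eq [PreconnectedSpace C]
    (hf : MDifferentiable 𝓘(ℂ) 𝓘(ℂ) f) {x : C} (hx : ∀ᶠ y in 𝓝 x, f y = f x) (y z : C) :
    f y = f z := by
  let E : Set C := {x | ∀ᶠ y in 𝓝 x, f y = f x}
  have hE : IsOpen E := by
    refine isOpen_iff_mem_nhds.2 fun x hx => ?_
    have hx' : ∀ᶠ y in 𝓝 x, f y = f x := hx
    filter_upwards [hx'.eventually_nhds, hx'] with y hy hyx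
    filter_upwards [hy] with z hz
    rw [hz, hyx]
  have hE' : IsClosed E := by
    refine isClosed_of_closure_subset fun x hx => ?_
    obtain ⟨r, hr, htarget, hsource, han⟩ := hf.exists_ball_analyticOnNhd x
    set φ := chartAt ℂ x
    set ψ := chartAt ℂ (f x)
    have hxφ : x ∈ φ.source := mem_chart_source ℂ x
    have hnear : ∀ᶠ y in 𝓝 x, y ∈ φ.source ∧ φ y ∈ Metric.ball (φ x) r :=
      Eventually.and (φ.open_source.mem_nhds hxφ)
        ((φ.continuousAt hxφ).eventually (Metric.ball_mem_nhds _ hr))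
    obtain ⟨y, ⟨hyφ, hyr⟩, hyE⟩ := mem_closure_iff_nhds.1 hx _ hnear
    have hconst : EqOn (fun w => ψ (f (φ.symm w))) (fun _ => ψ (f y)) (Metric.ball (φ x) r) := by
      refine han.eqOn_of_preconnected_of_eventuallyEq analyticOnNhd_const
        (convex_ball _ _).isPreconnected hyr ?_
      filter_upwards [(φ.tendsto_symm hyφ).eventually hyE] with w hw
      rw [hw]
    have hψ : ∀ z, z ∈ φ.source ∧ φ z ∈ Metric.ball (φ x) r →
        f z ∈ ψ.source ∧ ψ (f z) = ψ (f y) := by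
      rintro z ⟨hzφ, hzr⟩
      have h1 := hsource _ hzr
      have h2 := hconst hzr
      simp only [φ.left_inv hzφ] at h1 h2
      exact ⟨h1, h2⟩
    have hxψ := hψ x hnear.self_of_nhds
    change ∀ᶠ z in 𝓝 x, f z = f x
    filter_upwards [hnear] with z hz
    exact ψ.injOn (hψ z hz).1 hxψ.1 ((hψ z hz).2.trans hxψ.2.symm)
  have hEuniv : E = univ := IsClopen.eq_univ ⟨hE', hE⟩ ⟨x, hx⟩
  have hloc : IsLocallyConstant f := (IsLocallyConstant.iff_eventually_eq f).2 fun x => by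
    have : x ∈ E := hEuniv ▸ mem_univ x
    exact this
  exact hloc.apply_eq_of_preconnectedSpace y z

/-- The fibres of a non-constant holomorphic map are discrete. -/
theorem MDifferentiable.eventually_nhdsNE_ne [T1Space M] [PreconnectedSpace C]
    (hf : MDifferentiable 𝓘(ℂ) 𝓘(ℂ) f) (hne : ∃ x y, f x ≠ f y) (s : M) (x : C) :
    ∀ᶠ y in 𝓝[≠] x, f y ≠ s := by
  by_cases hs : f x = s
  · subst hs
    obtain ⟨r, hr, -, -, han⟩ := hf.exists_ball_analyticOnNhd x
    have hxφ := mem_chart_source ℂ x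
    rcases (han _ (Metric.mem_ball_self hr)).eventually_eq_or_eventually_ne
      (analyticAt_const (v := chartAt ℂ (f x) (f x))) with h | h
    · obtain ⟨y, z, hyz⟩ := hne
      exact absurd (hf.eq_of_eventually_eq
        (eventually_eq_of_eventually_chartAt_eq hf.continuous h) y z) hyz
    · rw [eventually_nhdsWithin_iff] at h ⊢
      filter_upwards [((chartAt ℂ x).continuousAt hxφ).eventually h,
        (chartAt ℂ x).open_source.mem_nhds hxφ] with y hy hyφ hyx hyf
      refine hy (fun h' => hyx ((chartAt ℂ x).injOn hyφ hxφ h')) ?_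
      rw [(chartAt ℂ x).left_inv hyφ, hyf]
  · exact (hf.continuous.continuousAt.eventually_ne hs).filter_mono nhdsWithin_le_nhds

/-- The open mapping theorem for Riemann surfaces. -/
theorem MDifferentiable.isOpenMap [PreconnectedSpace C]
    (hf : MDifferentiable 𝓘(ℂ) 𝓘(ℂ) f) (hne : ∃ x y, f x ≠ f y) : IsOpenMap f := by
  refine isOpenMap_iff_nhds_le.2 fun x => ?_
  obtain ⟨r, hr, -, -, han⟩ := hf.exists_ball_analyticOnNhd x
  have hmap := (han _ (Metric.mem_ball_self hr)).eventually_constant_or_nhds_le_map_nhds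
  set φ := chartAt ℂ x
  set ψ := chartAt ℂ (f x)
  have hxφ : x ∈ φ.source := mem_chart_source ℂ x
  have hxψ : f x ∈ ψ.source := mem_chart_source ℂ (f x)
  simp only [φ.left_inv hxφ] at hmap
  rcases hmap with h | h
  · obtain ⟨y, z, hyz⟩ := hne
    exact absurd (hf.eq_of_eventually_eq
      (eventually_eq_of_eventually_chartAt_eq hf.continuous h) y z) hyz
  · -- Transport the inclusion of filters back through the two charts.
    have h1 : map ψ (𝓝 (f x)) ≤ map ψ (map f (𝓝 x)) := by
      rw [ψ.map_nhds_eq hxψ]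
      refine h.trans_eq ?_
      have h2 := φ.symm.map_nhds_eq (φ.map_source hxφ)
      rw [φ.left_inv hxφ] at h2
      rw [← h2, map_map, map_map]
      rfl
    have h3 := map_mono (m := ψ.symm) h1
    have hid : ∀ l : Filter M, l ≤ 𝓝 (f x) → map ψ.symm (map ψ l) = l := by
      intro l hl
      rw [map_map]
      refine (map_congr ?_).trans map_id
      filter_upwards [hl (ψ.open_source.mem_nhds hxψ)] with y hy
      exact ψ.left_inv hy
    rwa [hid _ le_rfl, hid _ hf.continuous.continuousAt] at h3

theorem surjective_of_mdifferentiable [PreconnectedSpace C] [CompactSpace C] [T2Space M]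
    [PreconnectedSpace M] (hf : MDifferentiable 𝓘(ℂ) 𝓘(ℂ) f) (hne : ∃ x y, f x ≠ f y) :
    Function.Surjective f := by
  obtain ⟨x, -⟩ := id hne
  exact range_eq_univ.1 (IsClopen.eq_univ
    ⟨(isCompact_range hf.continuous).isClosed, (hf.isOpenMap hne).isOpen_range⟩ ⟨f x, x, rfl⟩)

theorem isPathConnected_preimage_compl [ConnectedSpace C] [T1Space M] {S : Set M}
    (hS : S.Finite) (hf : MDifferentiable 𝓘(ℂ) 𝓘(ℂ) f) (hne : ∃ x y, f x ≠ f y) :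
    IsPathConnected (f ⁻¹' Sᶜ) := by
  have : LocallyPathConnectedSpace C := ChartedSpace.locallyPathConnectedSpace ℂ C
  have hev : ∀ x, ∀ᶠ y in 𝓝[≠] x, y ∈ f ⁻¹' Sᶜ := by
    intro x
    have := (eventually_all_finite hS).2 fun s _ => hf.eventually_nhdsNE_ne hne s x
    filter_upwards [this] with y hy hyS
    exact hy _ hyS rfl
  have hopen : IsOpen (f ⁻¹' Sᶜ) := hS.isClosed.isOpen_compl.preimage hf.continuous
  exact hopen.isConnected_iff_isPathConnected.1
    ⟨(dense_of_eventually_nhdsNE_mem hev).nonempty, isPreconnected_of_eventually_nhdsNE_mem hev⟩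

end Holomorphic

/-! ### Monodromy of covering maps -/

section Monodromy

theorem Path.Homotopic.Quotient.cast_cast_self {X : Type*} [TopologicalSpace X] {x y x' y' : X}
    (γ : Path.Homotopic.Quotient x y) (hx : x' = x) (hy : y' = y) (hx' : x = x') (hy' : y = y') :
    (γ.cast hx hy).cast hx' hy' = γ := by
  simp

variable {E X : Type*} [TopologicalSpace E] [TopologicalSpace X] {p : E → X}

/-- The image of the fundamental group of the covering space is the stabilizer of the base point
under monodromy. -/
theorem IsCoveringMap.mem_range_mapOfEq_iff (cov : IsCoveringMap p) {x : X} (e : p ⁻¹' {x})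
    (γ : FundamentalGroup X x) :
    γ ∈ (FundamentalGroup.mapOfEq ⟨p, cov.continuous⟩ e.2).range ↔
      cov.monodromyPerm x γ e = e := by
  constructor
  · rintro ⟨Γ, rfl⟩
    refine cov.monodromy_eq_of_map_eq Γ ?_
    refine Eq.trans ?_ (congrArg (fun δ : Path.Homotopic.Quotient x x => δ.cast e.2 e.2)
      (FundamentalGroup.mapOfEq_apply ⟨p, cov.continuous⟩ e.2 Γ).symm)
    exact (Path.Homotopic.Quotient.cast_cast_self
      (Path.Homotopic.Quotient.map Γ ⟨p, cov.continuous⟩) _ _ _ _).symm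
  · intro h
    have h' : cov.monodromy γ e = e := h
    refine ⟨(cov.liftPathQuotient γ e).cast rfl congr($h'.symm), ?_⟩
    refine (FundamentalGroup.mapOfEq_apply ⟨p, cov.continuous⟩ e.2 _).trans ?_
    rw [Path.Homotopic.Quotient.map_cast, IsCoveringMap.map_liftPathQuotient]
    exact (congrArg (fun δ : Path.Homotopic.Quotient _ _ => δ.cast e.2.symm e.2.symm)
      (Path.Homotopic.Quotient.cast_cast _ _ _ _ _)).trans
      (Path.Homotopic.Quotient.cast_cast_self γ _ _ _ _)

theorem IsCoveringMap.exists_monodromyPerm_eq [PathConnectedSpace E] (cov : IsCoveringMap p)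
    {x : X} (e e' : p ⁻¹' {x}) : ∃ γ, cov.monodromyPerm x γ e = e' := by
  let Γ : Path.Homotopic.Quotient e.1 e'.1 := .mk (PathConnectedSpace.somePath e.1 e'.1)
  let γ : Path.Homotopic.Quotient x x := (Γ.map ⟨p, cov.continuous⟩).cast e.2.symm e'.2.symm
  have hγ : cov.monodromy γ e = e' := cov.monodromy_eq_of_map_eq Γ
    (Path.Homotopic.Quotient.cast_cast_self (Γ.map ⟨p, cov.continuous⟩) _ _ _ _).symm
  exact ⟨γ, hγ⟩

end Monodromy

/-! ### Diagonal actions on a product -/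

section Diagonal

variable {G A B : Type*} [Group G] (φ : G →* Equiv.Perm A) (ψ : G →* Equiv.Perm B)

/-- If the diagonal action is transitive, `γ ∈ G` factors through an element of the
stabilizer of `a` which moves `b` to `γ b`. -/
theorem stabilizer_mul_stabilizer_eq_univ
    (h : ∀ x y : A × B, ∃ γ, (φ γ x.1, ψ γ x.2) = y) (a : A) (b : B) :
    {γ | φ γ a = a} * {γ | ψ γ b = b} = (univ : Set G) := by
  refine eq_univ_of_forall fun γ => ?_
  obtain ⟨δ, hδ⟩ := h (a, b) (a, ψ γ b)
  obtain ⟨hδa, hδb⟩ := Prod.mk.inj hδ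
  refine ⟨δ, hδa, δ⁻¹ * γ, ?_, mul_inv_cancel_left δ γ⟩
  change ψ (δ⁻¹ * γ) b = b
  rw [map_mul, Equiv.Perm.mul_apply, ← hδb, map_inv]
  exact (ψ δ).symm_apply_apply b

theorem exists_diagonal_eq_of_mul_eq_univ (hφ : ∀ a a', ∃ γ, φ γ a = a')
    (hψ : ∀ b b', ∃ γ, ψ γ b = b')
    (h : ∀ a b, {γ | φ γ a = a} * {γ | ψ γ b = b} = (univ : Set G)) (x y : A × B) :
    ∃ γ, (φ γ x.1, ψ γ x.2) = y := by
  obtain ⟨α, hα⟩ := hφ x.1 y.1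
  obtain ⟨β, hβ⟩ := hψ x.2 y.2
  -- Writing `α⁻¹ β = σ τ` with `σ` fixing `x.1` and `τ` fixing `x.2`, the element `α σ = β τ⁻¹`
  -- acts on `x.1` as `α` and on `x.2` as `β`.
  obtain ⟨σ, hσ, τ, hτ, hστ⟩ : α⁻¹ * β ∈ {γ | φ γ x.1 = x.1} * {γ | ψ γ x.2 = x.2} :=
    h x.1 x.2 ▸ mem_univ _
  have hστ' : α * σ = β * τ⁻¹ := by
    rw [eq_mul_inv_iff_mul_eq, mul_assoc]
    exact mul_eq_of_eq_inv_mul hστ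
  refine ⟨α * σ, Prod.ext ?_ ?_⟩
  · change φ (α * σ) x.1 = y.1
    rw [map_mul, Equiv.Perm.mul_apply, show φ σ x.1 = x.1 from hσ, hα]
  · change ψ (α * σ) x.2 = y.2
    rw [hστ', map_mul, Equiv.Perm.mul_apply, map_inv,
      Equiv.Perm.inv_eq_iff_eq.2 (show ψ τ x.2 = x.2 from hτ).symm, hβ]

end Diagonal

/-! ### Irreducible pairs -/

section Pairs

variable {C C₁ C₂ : Type*}
  [TopologicalSpace C] [ChartedSpace ℂ C] [IsManifold 𝓘(ℂ) 1 C] [T2Space C] [CompactSpace C]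
  [TopologicalSpace C₁] [ChartedSpace ℂ C₁] [IsManifold 𝓘(ℂ) 1 C₁] [T2Space C₁] [CompactSpace C₁]
  [TopologicalSpace C₂] [ChartedSpace ℂ C₂] [IsManifold 𝓘(ℂ) 1 C₂] [T2Space C₂] [CompactSpace C₂]
  {S : Set CP1} {f : C₁ → CP1} {g : C₂ → CP1} {z₀ : ↥Sᶜ}

theorem coe_coveringSubgroup {p : C → CP1} (hp : IsHolomorphicUnramifiedOutside p S)
    (e : punctFiber p z₀) : (coveringSubgroup hp e : Set (FundamentalGroup ↥Sᶜ z₀)) =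
      {γ | hp.isCoveringMap.monodromyPerm z₀ γ e = e} :=
  Set.ext fun γ => hp.isCoveringMap.mem_range_mapOfEq_iff e γ

theorem exists_monodromyPerm_eq_of_isHolomorphicUnramifiedOutside [ConnectedSpace C] {p : C → CP1}
    (hp : IsHolomorphicUnramifiedOutside p S) (hS : S.Finite) (e e' : punctFiber p z₀) :
    ∃ γ, hp.isCoveringMap.monodromyPerm z₀ γ e = e' := by
  have : PathConnectedSpace ↥(p ⁻¹' Sᶜ) := isPathConnected_iff_pathConnectedSpace.1
    (isPathConnected_preimage_compl hS hp.holomorphic hp.nonconstant)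
  exact hp.isCoveringMap.exists_monodromyPerm_eq e e'

omit [T2Space C] in
theorem nonempty_punctFiber [ConnectedSpace C] {p : C → CP1}
    (hp : IsHolomorphicUnramifiedOutside p S) (z₀ : ↥Sᶜ) : Nonempty (punctFiber p z₀) := by
  obtain ⟨x, hx⟩ := surjective_of_mdifferentiable hp.holomorphic hp.nonconstant z₀
  exact ⟨⟨⟨x, by rw [mem_preimage, hx]; exact z₀.2⟩, Subtype.ext hx⟩⟩

/-- The permutations `pairPerm hf hg z₀ γ` already form a group, so the orbits of the group they
generate are those of the loops themselves. -/
theorem mem_pairMonodromyGroup_iff (hf : IsHolomorphicUnramifiedOutside f S)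
    (hg : IsHolomorphicUnramifiedOutside g S)
    {σ : Equiv.Perm (punctFiber f z₀ × punctFiber g z₀)} :
    σ ∈ pairMonodromyGroup hf hg z₀ ↔ ∃ γ, pairPerm hf hg z₀ γ = σ := by
  let Φ : FundamentalGroup ↥Sᶜ z₀ →* Equiv.Perm (punctFiber f z₀ × punctFiber g z₀) :=
    { toFun := pairPerm hf hg z₀
      map_one' := by
        rw [pairPerm, map_one, map_one]
        rfl
      map_mul' := fun γ δ => by
        rw [pairPerm, map_mul, map_mul]
        rfl }
  have : pairMonodromyGroup hf hg z₀ = Φ.range := by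
    rw [pairMonodromyGroup, show range (pairPerm hf hg z₀) = (Φ.range : Set _) from rfl,
      Subgroup.closure_eq]
  rw [this]
  rfl

theorem isIrreduciblePair_iff [ConnectedSpace C₁] [ConnectedSpace C₂]
    (hf : IsHolomorphicUnramifiedOutside f S) (hg : IsHolomorphicUnramifiedOutside g S) :
    IsIrreduciblePair hf hg z₀ ↔ ∀ x y : punctFiber f z₀ × punctFiber g z₀,
      ∃ γ, (hf.isCoveringMap.monodromyPerm z₀ γ x.1,
        hg.isCoveringMap.monodromyPerm z₀ γ x.2) = y := by
  have := nonempty_punctFiber hf z₀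
  have := nonempty_punctFiber hg z₀
  rw [IsIrreduciblePair, numTransitivitySets, Nat.card_eq_one_iff_unique,
    ← MulAction.pretransitive_iff_subsingleton_quotient, MulAction.isPretransitive_iff]
  constructor
  · rintro ⟨h, -⟩ x y
    obtain ⟨⟨σ, hσ⟩, hxy⟩ := h x y
    obtain ⟨γ, rfl⟩ := (mem_pairMonodromyGroup_iff hf hg).1 hσ
    exact ⟨γ, hxy⟩
  · intro h
    refine ⟨fun x y => ?_, Nonempty.map (Quotient.mk _) inferInstance⟩
    obtain ⟨γ, hγ⟩ := h x y
    exact ⟨⟨_, (mem_pairMonodromyGroup_iff hf hg).2 ⟨γ, rfl⟩⟩, hγ⟩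

end Pairs

theorem theorem3p2
    {C₁ : Type*} [TopologicalSpace C₁] [T2Space C₁] [CompactSpace C₁] [ConnectedSpace C₁]
    [ChartedSpace ℂ C₁] [IsManifold 𝓘(ℂ) 1 C₁]
    {C₂ : Type*} [TopologicalSpace C₂] [T2Space C₂] [CompactSpace C₂] [ConnectedSpace C₂]
    [ChartedSpace ℂ C₂] [IsManifold 𝓘(ℂ) 1 C₂]
    (f : C₁ → CP1) (g : C₂ → CP1) (S : Set CP1) (hS : S.Finite)
    (hf : IsHolomorphicUnramifiedOutside f S) (hg : IsHolomorphicUnramifiedOutside g S)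
    (z₀ : ↥Sᶜ) :
    IsIrreduciblePair hf hg z₀ ↔
      ∀ (a : punctFiber f z₀) (b : punctFiber g z₀),
        (coveringSubgroup hf a : Set (FundamentalGroup ↥Sᶜ z₀)) *
              (coveringSubgroup hg b : Set (FundamentalGroup ↥Sᶜ z₀)) =
            (coveringSubgroup hg b : Set (FundamentalGroup ↥Sᶜ z₀)) *
              (coveringSubgroup hf a : Set (FundamentalGroup ↥Sᶜ z₀)) ∧
          (coveringSubgroup hg b : Set (FundamentalGroup ↥Sᶜ z₀)) *
              (coveringSubgroup hf a : Set (FundamentalGroup ↥Sᶜ z₀)) = Set.univ := by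
  rw [isIrreduciblePair_iff hf hg]
  simp only [coe_coveringSubgroup]
  constructor
  · intro h a b
    have hab := stabilizer_mul_stabilizer_eq_univ _ _ h a b
    have hba := stabilizer_mul_stabilizer_eq_univ (hg.isCoveringMap.monodromyPerm z₀)
      (hf.isCoveringMap.monodromyPerm z₀)
      (fun x y => (h x.swap y.swap).imp fun γ hγ => congrArg Prod.swap hγ) b a
    exact ⟨hab.trans hba.symm, hba⟩
  · intro h
    exact exists_diagonal_eq_of_mul_eq_univ _ _
      (exists_monodromyPerm_eq_of_isHolomorphicUnramifiedOutside hf hS)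
      (exists_monodromyPerm_eq_of_isHolomorphicUnramifiedOutside hg hS)
      fun a b => (h a b).1.trans (h a b).2
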